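/- Let $1<\alpha\le 2$, $T\ge 0$, $N\ge 0$, and let $\vec a(0),\dots,\vec a(N)\in\mathbb C^T$. For $z\in\mathbb C$ and $\beta>0$ put $z^{<\beta>}=|z|^{\beta-1}\bar z$, coordinatewise for vectors. A \emph{spectral density} is an integrable function $f$ on $(-\pi,\pi]$ with values in the complex $T\times T$ matrices such that, for almost every $\theta$, $u\mapsto u^{\top}f(\theta)u^{<\alpha-1>}$ is the $\alpha$-th power of a seminorm on $\mathbb C^T$ (for $T=1$: $f\ge 0$; for $\alpha=2$: $f(\theta)$ is Hermitian positive semidefinite). $L^\alpha(f)$ consists of the measurable $u:(-\pi,\pi]\to\mathbb C^T$ with $\|u\|^\alpha_{L^\alpha(f)}=\int_{-\pi}^{\pi}u^{\top}f\,u^{<\alpha-1>}d\theta<\infty$, and $L_N^\alpha(f)$ is the closed subspace generated by $e^{ij\theta}\delta_k$, $j\in\mathbb Z\setminus\{0,\dots,N\}$, $k=1,\dots,T$, where $\delta_1,\dots,\delta_T$ is the standard basis of $\mathbb C^T$. Let $A_N(e^{i\theta})=\sum_{j=0}^N\vec a(j)e^{ij\theta}$ and $$\Delta(h;f)=\int_{-\pi}^{\pi}\bigl(A_N(e^{i\theta})-h(\theta)\bigr)^{\top}f(\theta)\bigl(A_N(e^{i\theta})-h(\theta)\bigr)^{<\alpha-1>}d\theta,\qquad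 \Delta(f)=\inf_{h\in L_N^\alpha(f)}\Delta(h;f).$$ Let $D_f$ be a set of spectral densities and $H_D=\bigcap_{f\in D_f}L_N^\alpha(f)$. Call $f_0\in D_f$ \emph{least favorable} if $\Delta(f_0)=\max_{f\in D_f}\Delta(f)$. Call $h^0\in H_D$ \emph{minimax (robust)} if $\max_{f\in D_f}\Delta(h^0;f)$ is attained and equals $\min_{h\in H_D}\sup_{f\in D_f}\Delta(h;f)$. A $T$-dimensional sequence $\vec\xi(n)$, $n\in\mathbb Z$, of jointly symmetric $\alpha$-stable complex random vectors is \emph{harmonizable with spectral density $f$} if $\vec\xi(n)=\int_{-\pi}^{\pi}e^{in\theta}d\vec Z(\theta)$ (limit in probability of Riemann sums) for a symmetric $\alpha$-stable process $\vec Z$ on $[-\pi,\pi]$ with independent increments and matrix spectral measure $f(\theta)d\theta$, that is, for $u,v\in\mathbb C^T$ and $s\le t$ the covariation of $u^{\top}(\vec Z(t)-\vec Z(s))$ with $v^{\top}(\vec Z(t)-\vec Z(s))$ is $u^{\top}\bigl(\int_s^tf\,d\theta\bigr)v^{<\alpha-1>}$, and if moreover, for all vector trigonometric polynomials $p,q$,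 the covariation of $\int p^{\top}d\vec Z$ with $\int q^{\top}d\vec Z$ is $\int_{-\pi}^{\pi}p^{\top}f\,q^{<\alpha-1>}d\theta$. Here the covariation of jointly symmetric $\alpha$-stable complex variables is $[X,Y]_\alpha=\int x\,y^{<\alpha-1>}d\Gamma(x,y)$, with $\Gamma$ a (finite, symmetric) spectral measure of $(X,Y)$ on the unit sphere of $\mathbb C^2=\mathbb R^4$, and $\|X\|_\alpha^\alpha=[X,X]_\alpha$. Let $f_0\in D_f$ satisfy the minimality condition: $f_0(\theta)$ is positive definite for almost every $\theta$ and $\int_{-\pi}^{\pi}\mathrm{Tr}\,[f_0(\theta)^{-1/(\alpha-1)}]\,d\theta<\infty$. Let $\vec\xi$ be a harmonizable symmetric $\alpha$-stable sequence with spectral density $f_0$, and let $h^0=h(f_0)\in L_N^\alpha(f_0)$ be the spectral characteristic of the optimal linear estimate $\hat A_N\vec\xi$ of $A_N\vec\xi=\sum_{j=0}^N\vec a(j)^{\top}\vec\xi(j)$; that is, $\hat A_N\vec\xi=\int (h^0)^{\top}d\vec Z$ minimizes $\|A_N\vec\xi-Y\|_\alpha$ over all $Y$ in the closed linear manifold generated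 by the components of $\vec\xi(j)$, $j\in\mathbb Z\setminus\{0,\dots,N\}$. If $\max_{f\in D_f}\Delta(h(f_0);f)=\Delta(h(f_0);f_0)$ and $h(f_0)\in H_D$, then $\Delta(f_0)=\Delta(h(f_0);f_0)$, $f_0$ is least favorable in $D_f$, and $h(f_0)$ is minimax (robust). -/

import Mathlib

open MeasureTheory ProbabilityTheory Filter Topology Set
open scoped ENNReal Matrix ComplexOrder

noncomputable section

namespace StableInterpolation

/-! ### Symmetric stable random variables and covariation -/

/-- The signed power `z^{<β>} = |z|^{β-1} z̄` of a complex number. -/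
def spow (β : ℝ) (z : ℂ) : ℂ := ((‖z‖ ^ (β - 1) : ℝ) : ℂ) * (starRingEnd ℂ) z

/-- A real random variable is symmetric `α`-stable: its characteristic function is
`exp(-c|t|^α)` for some `c ≥ 0`. -/
def IsSaS {Ω : Type*} [MeasurableSpace Ω] (α : ℝ) (P : Measure Ω) (X : Ω → ℝ) : Prop :=
  AEMeasurable X P ∧
    ∃ c : ℝ, 0 ≤ c ∧ ∀ t : ℝ, charFun (P.map X) t = Complex.exp (-((c * |t| ^ α : ℝ) : ℂ))

/-- A family of complex random variables is jointly symmetric `α`-stable: every finite real linear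
combination of the real and imaginary parts (that is, every `Re ∑ cᵢ Xᵢ` with complex `cᵢ`) is
symmetric `α`-stable. -/
def IsJointlySaS {Ω ι : Type*} [MeasurableSpace Ω] (α : ℝ) (P : Measure Ω) (X : ι → Ω → ℂ) : Prop :=
  ∀ c : ι →₀ ℂ, IsSaS α P (fun ω => (c.sum fun i z => z * X i ω).re)

/-- `Γ` is a spectral measure of the pair `(X, Y)` of complex random variables, regarded as a random
vector of `ℝ⁴ = ℂ × ℂ`: a finite symmetric measure carried by the Euclidean unit sphere with
`E exp(i Re(s̄ X + t̄ Y)) = exp(-∫ |Re(s̄ x + t̄ y)|^α dΓ(x, y))`. -/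
structure IsSpectralMeasure {Ω : Type*} [MeasurableSpace Ω] (α : ℝ) (P : Measure Ω) (X Y : Ω → ℂ)
    (Γ : Measure (ℂ × ℂ)) : Prop where
  finite : IsFiniteMeasure Γ
  symmetric : Γ.map (fun z => -z) = Γ
  sphere : ∀ᵐ z ∂Γ, ‖z.1‖ ^ 2 + ‖z.2‖ ^ 2 = 1
  charFun_eq : ∀ s t : ℂ,
    ∫ ω, Complex.exp (Complex.I *
        (((starRingEnd ℂ) s * X ω + (starRingEnd ℂ) t * Y ω).re : ℂ)) ∂P =
      Complex.exp
        (-((∫ z, |((starRingEnd ℂ) s * z.1 + (starRingEnd ℂ) t * z.2).re| ^ α ∂Γ : ℝ) : ℂ))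

/-- The covariation `[X, Y]_α` exists and equals `r`. The number `r` does not depend on the choice
of `Γ`. In particular `HasCovariation α P X X r` says `‖X‖_α^α = r`. -/
def HasCovariation {Ω : Type*} [MeasurableSpace Ω] (α : ℝ) (P : Measure Ω) (X Y : Ω → ℂ)
    (r : ℂ) : Prop :=
  AEMeasurable X P ∧ AEMeasurable Y P ∧
    ∃ Γ : Measure (ℂ × ℂ), IsSpectralMeasure α P X Y Γ ∧ r = ∫ z, z.1 * spow (α - 1) z.2 ∂Γ

/-! ### Spectral densities -/

/-- The form `uᵀ F v^{<α-1>}`, the signed power being taken in each coordinate. -/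
def covForm {T : ℕ} (α : ℝ) (F : Matrix (Fin T) (Fin T) ℂ) (u v : Fin T → ℂ) : ℂ :=
  u ⬝ᵥ (F *ᵥ (fun k => spow (α - 1) (v k)))

/-- Spectral densities on `(-π, π]` of `T`-dimensional harmonizable symmetric `α`-stable sequences:
measurable, integrable, and such that for almost every `θ` the expression `uᵀ f(θ) u^{<α-1>}` is the
`α`-th power of a seminorm of `u`. For `T = 1` the last condition says `f ≥ 0`; for `α = 2` it
says that `f(θ)` is Hermitian positive semidefinite. -/
structure IsSpectralDensity {T : ℕ} (α : ℝ) (f : ℝ → Matrix (Fin T) (Fin T) ℂ) : Prop where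
  integrable : ∀ k l, IntegrableOn (fun θ => f θ k l) (Ioc (-Real.pi) Real.pi)
  seminorm : ∀ᵐ θ ∂(volume.restrict (Ioc (-Real.pi) Real.pi)),
    ∃ ν : Seminorm ℂ (Fin T → ℂ), ∀ u, covForm α (f θ) u u = ((ν u ^ α : ℝ) : ℂ)

/-- The minimality condition `∫ Tr[f(θ)^{-1/(α-1)}] dθ < ∞`. The negative power of the matrix
`f(θ)` makes sense when it is positive definite, and is taken in the functional calculus. -/
def IsMinimal {T : ℕ} (α : ℝ) (f : ℝ → Matrix (Fin T) (Fin T) ℂ) : Prop :=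
  (∀ᵐ θ ∂(volume.restrict (Ioc (-Real.pi) Real.pi)), (f θ).PosDef) ∧
    ∫⁻ θ in Ioc (-Real.pi) Real.pi,
      ENNReal.ofReal (cfc (fun x : ℝ => x ^ (-1 / (α - 1))) (f θ)).trace.re < ∞

/-! ### Harmonizable sequences -/

/-- The trigonometric polynomial `θ ↦ ∑ e^{inθ} c(n)` with vector coefficients. -/
def trigPoly {T : ℕ} (c : ℤ →₀ (Fin T → ℂ)) (θ : ℝ) : Fin T → ℂ :=
  c.sum fun n v => Complex.exp (Complex.I * n * θ) • v

/-- The linear combination `∑ c(n)ᵀ ξ(n)` of values of the sequence. -/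
def linComb {Ω : Type*} {T : ℕ} (ξ : ℤ → Fin T → Ω → ℂ) (c : ℤ →₀ (Fin T → ℂ)) (ω : Ω) : ℂ :=
  c.sum fun n v => v ⬝ᵥ (fun k => ξ n k ω)

/-- `ξ` is a `T`-dimensional harmonizable symmetric `α`-stable sequence whose (matrix) spectral
measure is absolutely continuous with density `f`: `ξ(n) = ∫ e^{inθ} dZ(θ)` for a vector symmetric
`α`-stable process `Z` on `[-π, π]` with independent increments and spectral measure `f(θ)dθ`. -/
def IsHarmonizable {Ω : Type*} [MeasurableSpace Ω] {T : ℕ} (α : ℝ) (P : Measure Ω)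
    (ξ : ℤ → Fin T → Ω → ℂ) (f : ℝ → Matrix (Fin T) (Fin T) ℂ) : Prop :=
  (∀ n k, Measurable (ξ n k)) ∧
  IsJointlySaS α P (fun i : ℤ × Fin T => ξ i.1 i.2) ∧
  (∃ Z : ℝ → Fin T → Ω → ℂ,
    (∀ θ k, Measurable (Z θ k)) ∧
    IsJointlySaS α P (fun i : Icc (-Real.pi) Real.pi × Fin T => Z i.1 i.2) ∧
    -- independent increments
    (∀ (m : ℕ) (t : ℕ → ℝ), Monotone t → (∀ j, t j ∈ Icc (-Real.pi) Real.pi) →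
      iIndepFun (fun (j : Fin m) ω k => Z (t (j + 1)) k ω - Z (t j) k ω) P) ∧
    -- spectral measure of the increments
    (∀ s t : ℝ, -Real.pi ≤ s → s ≤ t → t ≤ Real.pi → ∀ u v : Fin T → ℂ,
      HasCovariation α P (fun ω => u ⬝ᵥ fun k => Z t k ω - Z s k ω)
        (fun ω => v ⬝ᵥ fun k => Z t k ω - Z s k ω)
        (covForm α (Matrix.of fun k l => ∫ θ in s..t, f θ k l) u v)) ∧
    -- `ξ(n) = ∫ e^{inθ} dZ(θ)` as a limit in probability of Riemann sums
    (∀ (n : ℤ) (k : Fin T), TendstoInMeasure P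
      (fun (m : ℕ) ω => ∑ j ∈ Finset.range m,
        Complex.exp (Complex.I * n * ((-Real.pi + 2 * Real.pi * j / m : ℝ) : ℂ)) *
          (Z (-Real.pi + 2 * Real.pi * (j + 1) / m) k ω - Z (-Real.pi + 2 * Real.pi * j / m) k ω))
      atTop (ξ n k))) ∧
  -- covariation representation `[∫ pᵀ dZ, ∫ qᵀ dZ]_α = ∫ pᵀ f q^{<α-1>} dθ`
  ∀ p q : ℤ →₀ (Fin T → ℂ), HasCovariation α P (linComb ξ p) (linComb ξ q)
    (∫ θ in (-Real.pi)..Real.pi, covForm α (f θ) (trigPoly p θ) (trigPoly q θ))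

/-! ### Linear estimates and their spectral characteristics -/

/-- All frequencies of `c` lie outside `{0, 1, …, N}`. -/
def IsObserved {T : ℕ} (N : ℕ) (c : ℤ →₀ (Fin T → ℂ)) : Prop :=
  ∀ n ∈ c.support, ¬ (0 ≤ n ∧ n ≤ (N : ℤ))

/-- `‖u‖^α` in `L^α(f)`: the integral `∫ uᵀ f u^{<α-1>} dθ`. -/
def normPow {T : ℕ} (α : ℝ) (f : ℝ → Matrix (Fin T) (Fin T) ℂ) (u : ℝ → Fin T → ℂ) : ℝ≥0∞ :=
  ∫⁻ θ in Ioc (-Real.pi) Real.pi, ENNReal.ofReal (covForm α (f θ) (u θ) (u θ)).re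

/-- The subspace `L_N^α(f)`: the closure in `L^α(f)` of the trigonometric polynomials with
frequencies outside `{0, 1, …, N}`. -/
def LN {T : ℕ} (α : ℝ) (N : ℕ) (f : ℝ → Matrix (Fin T) (Fin T) ℂ) : Set (ℝ → Fin T → ℂ) :=
  {h | AEMeasurable h (volume.restrict (Ioc (-Real.pi) Real.pi)) ∧ normPow α f h < ∞ ∧
    ∀ ε : ℝ≥0∞, 0 < ε → ∃ c : ℤ →₀ (Fin T → ℂ), IsObserved N c ∧
      normPow α f (fun θ => h θ - trigPoly c θ) < ε}

/-- `A_N(e^{iθ}) = ∑_{j=0}^N a(j) e^{ijθ}`. -/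
def targetPoly {T N : ℕ} (a : Fin (N + 1) → Fin T → ℂ) (θ : ℝ) : Fin T → ℂ :=
  ∑ j : Fin (N + 1), Complex.exp (Complex.I * ((j : ℕ) : ℂ) * θ) • a j

/-- The functional `A_N ξ = ∑_{j=0}^N a(j)ᵀ ξ(j)`. -/
def target {Ω : Type*} {T N : ℕ} (a : Fin (N + 1) → Fin T → ℂ) (ξ : ℤ → Fin T → Ω → ℂ)
    (ω : Ω) : ℂ :=
  ∑ j : Fin (N + 1), a j ⬝ᵥ (fun k => ξ ((j : ℕ) : ℤ) k ω)

/-- `Y` belongs to `H^N(ξ)`, the closed linear manifold generated by `ξ(j)`, `j ∉ {0, 1, …, N}`.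
Convergence in `‖·‖_α` is convergence in probability. -/
def IsEstimate {Ω : Type*} [MeasurableSpace Ω] {T : ℕ} (P : Measure Ω) (N : ℕ)
    (ξ : ℤ → Fin T → Ω → ℂ) (Y : Ω → ℂ) : Prop :=
  AEMeasurable Y P ∧ ∃ c : ℕ → ℤ →₀ (Fin T → ℂ), (∀ m, IsObserved N (c m)) ∧
    TendstoInMeasure P (fun m => linComb ξ (c m)) atTop Y

/-- `Y` is the estimate `∫ hᵀ dZ` in `H^N(ξ)` with spectral characteristic `h ∈ L_N^α(f)`: `Y` is
the image of `h` under the isomorphism between `L^α(f)` and `H(ξ)` which sends `e^{inθ}δ_k` to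
`ξ_k(n)`. -/
def HasCharacteristic {Ω : Type*} [MeasurableSpace Ω] {T : ℕ} (α : ℝ) (P : Measure Ω) (N : ℕ)
    (ξ : ℤ → Fin T → Ω → ℂ) (f : ℝ → Matrix (Fin T) (Fin T) ℂ) (Y : Ω → ℂ)
    (h : ℝ → Fin T → ℂ) : Prop :=
  AEMeasurable Y P ∧ h ∈ LN α N f ∧
    ∃ c : ℕ → ℤ →₀ (Fin T → ℂ), (∀ m, IsObserved N (c m)) ∧
      Tendsto (fun m => normPow α f (fun θ => h θ - trigPoly (c m) θ)) atTop (𝓝 0) ∧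
      TendstoInMeasure P (fun m => linComb ξ (c m)) atTop Y

/-- `Y` is the optimal linear estimate of `A_N ξ`: the element of `H^N(ξ)` at the least distance
`‖A_N ξ - Y‖_α` from `A_N ξ`. -/
def IsOptimalEstimate {Ω : Type*} [MeasurableSpace Ω] {T N : ℕ} (α : ℝ) (P : Measure Ω)
    (a : Fin (N + 1) → Fin T → ℂ) (ξ : ℤ → Fin T → Ω → ℂ) (Y : Ω → ℂ) : Prop :=
  IsEstimate P N ξ Y ∧
    ∃ r : ℝ, HasCovariation α P (fun ω => target a ξ ω - Y ω) (fun ω => target a ξ ω - Y ω) r ∧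
      ∀ Y' : Ω → ℂ, IsEstimate P N ξ Y' → ∀ r' : ℝ,
        HasCovariation α P (fun ω => target a ξ ω - Y' ω) (fun ω => target a ξ ω - Y' ω) r' →
        r ≤ r'

/-! ### Errors, least favorable densities, minimax characteristics -/

/-- The error `Δ(h; f) = ∫ (A_N - h)ᵀ f (A_N - h)^{<α-1>} dθ`. -/
def estError {T N : ℕ} (α : ℝ) (a : Fin (N + 1) → Fin T → ℂ) (h : ℝ → Fin T → ℂ)
    (f : ℝ → Matrix (Fin T) (Fin T) ℂ) : ℝ≥0∞ :=
  normPow α f (fun θ => targetPoly a θ - h θ)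

/-- The error of the optimal estimate, `Δ(f) = Δ(h(f); f) = min_{h ∈ L_N^α(f)} Δ(h; f)`. -/
def optimalError {T N : ℕ} (α : ℝ) (a : Fin (N + 1) → Fin T → ℂ)
    (f : ℝ → Matrix (Fin T) (Fin T) ℂ) : ℝ≥0∞ :=
  ⨅ h ∈ LN α N f, estError α a h f

/-- `f₀ ∈ D` is least favorable in `D`: `Δ(f₀) = max_{f ∈ D} Δ(f)`. -/
def IsLeastFavorable {T N : ℕ} (α : ℝ) (a : Fin (N + 1) → Fin T → ℂ)
    (D : Set (ℝ → Matrix (Fin T) (Fin T) ℂ)) (f₀ : ℝ → Matrix (Fin T) (Fin T) ℂ) : Prop :=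
  f₀ ∈ D ∧ ∀ f ∈ D, optimalError α a f ≤ optimalError α a f₀

/-- `H_D = ⋂_{f ∈ D} L_N^α(f)`. -/
def HD {T : ℕ} (α : ℝ) (N : ℕ) (D : Set (ℝ → Matrix (Fin T) (Fin T) ℂ)) :
    Set (ℝ → Fin T → ℂ) :=
  ⋂ f ∈ D, LN α N f

/-- `h₀` is minimax (robust): `h₀ ∈ H_D`, the maximum of `Δ(h₀; ·)` over `D` is attained, and it is
the least value of `sup_{f ∈ D} Δ(h; f)` over `h ∈ H_D`. -/
def IsMinimax {T N : ℕ} (α : ℝ) (a : Fin (N + 1) → Fin T → ℂ)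
    (D : Set (ℝ → Matrix (Fin T) (Fin T) ℂ)) (h₀ : ℝ → Fin T → ℂ) : Prop :=
  h₀ ∈ HD α N D ∧
    ∃ M : ℝ≥0∞, IsGreatest (estError α a h₀ '' D) M ∧
      IsLeast ((fun h => ⨆ f ∈ D, estError α a h f) '' HD α N D) M

end StableInterpolation

end

open StableInterpolation

namespace StableInterpolation

/-! ### The signed power and the covariation form -/

/-! Once `Δ(f₀) = Δ(h₀; f₀)` is known, this is the saddle point argument: `Δ(f) ≤ Δ(h₀; f) ≤ Δ(h₀;
f₀) = Δ(f₀)` for `f ∈ D`, and `Δ(h₀; f₀) = Δ(f₀) ≤ Δ(h; f₀) ≤ sup_f Δ(h; f)` for `h ∈ H_D`.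

The substance is that equality. Optimality of `Y₀` concerns `‖·‖_α` on a closure in probability,
while `Δ` lives in `L^α(f₀)`, and the covariation formula links the two only for trigonometric
polynomials. Let `r = ‖A_N ξ - Y₀‖_α^α`. Observed polynomials are competing estimates, so `r` is at
most each of their errors; by density and Minkowski's inequality
(`IsSpectralDensity.tendsto_normPow_sub`), `r ≤ Δ(h; f₀)` on all of `L_N^α(f₀)`. Conversely,
polynomials tending to `h₀` in `L^α(f₀)` give estimates tending to `Y₀` in probability. Their errors
tend to `Δ(h₀; f₀)`, and also to `r` by continuity of `‖·‖_α` (`tendsto_covariation_of_ae_tendsto`).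

That continuity comes from characteristic functions: the exponent of `X` averaged over the unit
circle is a fixed positive multiple of `‖X‖_α^α`. -/

lemma measurable_spow (β : ℝ) : Measurable (spow β) := by
  unfold spow
  fun_prop

lemma spow_neg (β : ℝ) (z : ℂ) : spow β (-z) = -spow β z := by
  simp [spow]

lemma norm_spow_le {β : ℝ} (hβ : 0 < β) (z : ℂ) : ‖spow β z‖ ≤ ‖z‖ ^ β := by
  rcases eq_or_ne z 0 with rfl | hz
  · simp [spow, Real.zero_rpow hβ.ne']
  · have h : 0 < ‖z‖ := norm_pos_iff.2 hz
    rw [spow, norm_mul, Complex.norm_real, RCLike.norm_conj, Real.norm_of_nonneg (by positivity),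
      ← Real.rpow_add_one h.ne', sub_add_cancel]

lemma mul_spow_self {α : ℝ} (hα : 1 < α) (z : ℂ) : z * spow (α - 1) z = ((‖z‖ ^ α : ℝ) : ℂ) := by
  rcases eq_or_ne z 0 with rfl | hz
  · simp [Real.zero_rpow (by linarith : α ≠ 0)]
  · have h : 0 < ‖z‖ := norm_pos_iff.2 hz
    rw [spow, mul_left_comm, Complex.mul_conj, Complex.normSq_eq_norm_sq, ← Complex.ofReal_mul,
      ← Real.rpow_natCast, ← Real.rpow_add h]
    congr 2
    push_cast
    ring

lemma covForm_neg {T : ℕ} (α : ℝ) (F : Matrix (Fin T) (Fin T) ℂ) (u : Fin T → ℂ) :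
    covForm α F (-u) (-u) = covForm α F u u := by
  have : (fun k => spow (α - 1) ((-u) k)) = -fun k => spow (α - 1) (u k) := by
    ext k
    simp [spow_neg]
  rw [covForm, this, Matrix.mulVec_neg, neg_dotProduct, dotProduct_neg, neg_neg, covForm]

/-! ### The spectral measure of a pair `(X, X)` -/

/-- The mean of `|cos|^α` over the circle, up to the factor `2π`. -/
noncomputable def cosMoment (α : ℝ) : ℝ := ∫ θ in (-Real.pi)..Real.pi, |Real.cos θ| ^ α

lemma continuous_abs_cos_rpow {α : ℝ} (hα : 0 ≤ α) : Continuous fun θ => |Real.cos θ| ^ α :=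
  Real.continuous_cos.abs.rpow_const fun _ => Or.inr hα

lemma cosMoment_pos {α : ℝ} (hα : 0 ≤ α) : 0 < cosMoment α := by
  refine intervalIntegral.integral_pos (by linarith [Real.pi_pos])
    (continuous_abs_cos_rpow hα).continuousOn (fun θ _ => by positivity)
    ⟨0, ⟨by linarith [Real.pi_pos], Real.pi_pos.le⟩, by simp⟩

/-- The unit complex number `e^{iθ}`. -/
noncomputable def unitPt (θ : ℝ) : ℂ := Complex.exp (θ * Complex.I)

lemma continuous_unitPt : Continuous unitPt := by
  unfold unitPt
  fun_prop

lemma norm_unitPt (θ : ℝ) : ‖unitPt θ‖ = 1 := Complex.norm_exp_ofReal_mul_I θ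

lemma re_conj_unitPt_mul (θ : ℝ) (z : ℂ) :
    ((starRingEnd ℂ) (unitPt θ) * z).re = ‖z‖ * Real.cos (θ + -z.arg) := by
  have h : (starRingEnd ℂ) (unitPt θ) = Complex.exp (((-θ : ℝ) : ℂ) * Complex.I) := by
    rw [unitPt, ← Complex.exp_conj]
    simp
  conv_lhs => rw [← Complex.norm_mul_exp_arg_mul_I z]
  rw [h, mul_left_comm, ← Complex.exp_add, ← add_mul, ← Complex.ofReal_add, Complex.re_ofReal_mul,
    Complex.exp_ofReal_mul_I_re, ← Real.cos_neg]
  congr 2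
  ring

/-- The argument of `z` only translates a periodic integrand, so the integral over a full period
sees `‖z‖` alone. -/
lemma integral_abs_re_conj_unitPt_mul_rpow (α : ℝ) (z : ℂ) :
    ∫ θ in (-Real.pi)..Real.pi, |((starRingEnd ℂ) (unitPt θ) * z).re| ^ α =
      cosMoment α * ‖z‖ ^ α := by
  have hper : Function.Periodic (fun θ => |Real.cos θ| ^ α) (2 * Real.pi) := fun θ => by
    simp [Real.cos_add_two_pi]
  have h := hper.intervalIntegral_add_eq (-Real.pi + -z.arg) (-Real.pi)
  simp_rw [re_conj_unitPt_mul, abs_mul, abs_norm, Real.mul_rpow (norm_nonneg _) (abs_nonneg _)]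
  rw [intervalIntegral.integral_const_mul, mul_comm (cosMoment α),
    intervalIntegral.integral_comp_add_right (fun θ => |Real.cos θ| ^ α), cosMoment]
  congr 1
  convert h using 2 <;> ring

lemma abs_re_conj_mul_rpow_le {α : ℝ} (hα : 0 ≤ α) (s z : ℂ) :
    |((starRingEnd ℂ) s * z).re| ^ α ≤ ‖s‖ ^ α * ‖z‖ ^ α := by
  rw [← Real.mul_rpow (norm_nonneg _) (norm_nonneg _)]
  refine Real.rpow_le_rpow (abs_nonneg _) ((Complex.abs_re_le_norm _).trans ?_) hα
  simp

/-- The exponent of the characteristic function of a complex variable `X` with `‖X‖_α^α = r`: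
it is dominated by `r` on the unit circle, where its integral is proportional to `r`. -/
structure IsStableExponent {Ω : Type*} [MeasurableSpace Ω] (α : ℝ) (P : Measure Ω) (X : Ω → ℂ)
    (r : ℝ) (φ : ℂ → ℝ) : Prop where
  measurable : Measurable φ
  nonneg : ∀ s, 0 ≤ φ s
  le : ∀ θ, φ (unitPt θ) ≤ r
  charFun_eq : ∀ s, ∫ ω, Complex.exp (Complex.I * (((starRingEnd ℂ) s * X ω).re : ℂ)) ∂P =
    Complex.exp (-(φ s : ℂ))
  integral_eq : ∫ θ in (-Real.pi)..Real.pi, φ (unitPt θ) = cosMoment α * r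

section

variable {Ω : Type*} [MeasurableSpace Ω] {α : ℝ} {P : Measure Ω} {X Y : Ω → ℂ}
  {Γ : Measure (ℂ × ℂ)}

lemma IsSpectralMeasure.integrable_rpow (hα : 0 < α) (h : IsSpectralMeasure α P X Y Γ) (s t : ℂ) :
    Integrable (fun z : ℂ × ℂ =>
      |((starRingEnd ℂ) s * z.1 + (starRingEnd ℂ) t * z.2).re| ^ α) Γ := by
  have := h.finite
  refine Integrable.of_bound (C := (‖s‖ + ‖t‖) ^ α) (Measurable.aestronglyMeasurable (by fun_prop)) ?_
  filter_upwards [h.sphere] with z hz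
  rw [Real.norm_of_nonneg (by positivity)]
  refine Real.rpow_le_rpow (abs_nonneg _) ((Complex.abs_re_le_norm _).trans ?_) hα.le
  have h1 : ‖z.1‖ ≤ 1 := by nlinarith [norm_nonneg z.1, sq_nonneg ‖z.2‖]
  have h2 : ‖z.2‖ ≤ 1 := by nlinarith [norm_nonneg z.2, sq_nonneg ‖z.1‖]
  refine (norm_add_le _ _).trans ?_
  simp only [norm_mul, RCLike.norm_conj]
  nlinarith [norm_nonneg s, norm_nonneg t]

/-- At `(s, -s)` the variable in the characteristic function is `0`, so the exponent, an integral of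
a nonnegative function against `Γ`, vanishes. -/
lemma IsSpectralMeasure.ae_fst_eq_snd [IsProbabilityMeasure P] (hα : 0 < α)
    (h : IsSpectralMeasure α P X X Γ) : ∀ᵐ z ∂Γ, z.1 = z.2 := by
  have key : ∀ s : ℂ, ∀ᵐ z ∂Γ, ((starRingEnd ℂ) s * z.1 + (starRingEnd ℂ) (-s) * z.2).re = 0 := by
    intro s
    have h1 := h.charFun_eq s (-s)
    have h0 : ∫ z, |((starRingEnd ℂ) s * z.1 + (starRingEnd ℂ) (-s) * z.2).re| ^ α ∂Γ = 0 := by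
      have h2 : (1 : ℂ) = Complex.exp (-((∫ z, |((starRingEnd ℂ) s * z.1 +
          (starRingEnd ℂ) (-s) * z.2).re| ^ α ∂Γ : ℝ) : ℂ)) := by
        rw [← h1]
        simp
      rw [← Complex.ofReal_neg, ← Complex.ofReal_exp] at h2
      rw [← Complex.ofReal_one, Complex.ofReal_inj] at h2
      linarith [(Real.exp_eq_one_iff _).1 h2.symm]
    rw [integral_eq_zero_iff_of_nonneg (fun z => by positivity) (h.integrable_rpow hα s (-s))] at h0
    filter_upwards [h0] with z hz
    simpa using (Real.rpow_eq_zero (abs_nonneg _) hα.ne').1 hz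
  -- `s = 1` compares real parts and `s = i` imaginary parts.
  filter_upwards [key 1, key Complex.I] with z h1 h2
  apply Complex.ext
  · simp at h1
    linarith
  · simp at h2
    linarith

/-- Since `Γ` lives on the diagonal, `r = ∫ ‖x‖^α dΓ` and the exponent is `∫ |Re(s̄x)|^α dΓ`. The
bound on the circle is `|Re(s̄x)| ≤ ‖x‖`; the circle integral follows from Fubini and rotation
invariance. -/
lemma HasCovariation.exists_isStableExponent [IsProbabilityMeasure P] (hα : 1 < α) {r : ℂ}
    (h : HasCovariation α P X X r) : ∃ φ, IsStableExponent α P X r.re φ := by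
  obtain ⟨-, -, Γ, hΓ, rfl⟩ := h
  have := hΓ.finite
  have hα0 : 0 < α := by linarith
  have heq : ∀ᵐ z ∂Γ, z.1 = z.2 := hΓ.ae_fst_eq_snd hα0
  have hint : ∀ s : ℂ, Integrable (fun z : ℂ × ℂ => |((starRingEnd ℂ) s * z.1).re| ^ α) Γ := by
    intro s
    simpa using hΓ.integrable_rpow hα0 s 0
  have hnorm : Integrable (fun z : ℂ × ℂ => ‖z.1‖ ^ α) Γ := by
    refine Integrable.of_bound (C := 1) (Measurable.aestronglyMeasurable (by fun_prop)) ?_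
    filter_upwards [hΓ.sphere] with z hz
    rw [Real.norm_of_nonneg (by positivity)]
    exact Real.rpow_le_one (norm_nonneg _)
      (by nlinarith [norm_nonneg z.1, sq_nonneg ‖z.2‖]) hα0.le
  have hr : (∫ z, z.1 * spow (α - 1) z.2 ∂Γ).re = ∫ z, ‖z.1‖ ^ α ∂Γ := by
    have : ∫ z, z.1 * spow (α - 1) z.2 ∂Γ = ∫ z, ((‖z.1‖ ^ α : ℝ) : ℂ) ∂Γ := by
      refine integral_congr_ae ?_
      filter_upwards [heq] with z hz
      rw [← hz, mul_spow_self hα]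
    rw [this, integral_complex_ofReal, Complex.ofReal_re]
  have hmeas : Measurable (Function.uncurry fun (s : ℂ) (z : ℂ × ℂ) =>
      |((starRingEnd ℂ) s * z.1).re| ^ α) := by
    unfold Function.uncurry
    fun_prop
  refine ⟨fun s => ∫ z, |((starRingEnd ℂ) s * z.1).re| ^ α ∂Γ,
    (hmeas.stronglyMeasurable.integral_prod_right).measurable,
    fun s => integral_nonneg fun z => by positivity, fun θ => ?_, fun s => ?_, ?_⟩
  · rw [hr]
    refine integral_mono (hint _) hnorm fun z => ?_
    simpa [norm_unitPt] using abs_re_conj_mul_rpow_le hα0.le (unitPt θ) z.1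
  · simpa using hΓ.charFun_eq s 0
  · rw [hr, intervalIntegral_integral_swap]
    · simp_rw [integral_abs_re_conj_unitPt_mul_rpow]
      rw [integral_const_mul]
    · have hm : Measurable fun p : ℝ × (ℂ × ℂ) => (unitPt p.1, p.2) := by
        have := continuous_unitPt.measurable
        fun_prop
      have hfin : IsFiniteMeasure (volume.restrict (Set.uIoc (-Real.pi) Real.pi)) := by
        rw [Set.uIoc]
        infer_instance
      refine (hnorm.comp_snd (volume.restrict (Set.uIoc (-Real.pi) Real.pi))).mono'
        (hmeas.comp hm).aestronglyMeasurable (Eventually.of_forall fun p => ?_)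
      have h0 := abs_re_conj_mul_rpow_le hα0.le (unitPt p.1) p.2.1
      rw [norm_unitPt, Real.one_rpow, one_mul] at h0
      simpa [Function.uncurry, abs_of_nonneg, Real.rpow_nonneg] using h0

/-- Convergence of characteristic functions gives pointwise convergence of exponents. The bound `B`
dominates them on the circle, so their circle integrals converge too, and `cosMoment α > 0` can be
divided out. -/
lemma tendsto_covariation_of_ae_tendsto [IsProbabilityMeasure P] (hα : 1 < α) {Xs : ℕ → Ω → ℂ}
    {rs : ℕ → ℂ} {r : ℂ} {B : ℝ} (hs : ∀ m, HasCovariation α P (Xs m) (Xs m) (rs m))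
    (h : HasCovariation α P X X r) (hB : ∀ m, (rs m).re ≤ B)
    (hlim : ∀ᵐ ω ∂P, Tendsto (fun m => Xs m ω) atTop (𝓝 (X ω))) :
    Tendsto (fun m => (rs m).re) atTop (𝓝 r.re) := by
  choose φ hφ using fun m => (hs m).exists_isStableExponent hα
  obtain ⟨ψ, hψ⟩ := h.exists_isStableExponent hα
  have hpt : ∀ s, Tendsto (fun m => φ m s) atTop (𝓝 (ψ s)) := by
    intro s
    have h1 : Tendsto (fun m => ∫ ω, Complex.exp (Complex.I *
        (((starRingEnd ℂ) s * Xs m ω).re : ℂ)) ∂P) atTop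
        (𝓝 (∫ ω, Complex.exp (Complex.I * (((starRingEnd ℂ) s * X ω).re : ℂ)) ∂P)) := by
      refine tendsto_integral_of_dominated_convergence (fun _ => 1) (fun m => ?_)
        (integrable_const _) (fun m => ?_) ?_
      · have := (hs m).1
        exact AEMeasurable.aestronglyMeasurable (by fun_prop)
      · exact Eventually.of_forall fun ω => by
          rw [mul_comm, Complex.norm_exp_ofReal_mul_I]
      · filter_upwards [hlim] with ω hω
        have hc : Continuous fun x : ℂ =>
          Complex.exp (Complex.I * (((starRingEnd ℂ) s * x).re : ℂ)) := by fun_prop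
        exact (hc.tendsto _).comp hω
    simp_rw [fun m => (hφ m).charFun_eq s, hψ.charFun_eq s, ← Complex.ofReal_neg,
      ← Complex.ofReal_exp] at h1
    have h2 := (Complex.continuous_re.tendsto _).comp h1
    -- Both sides are exponentials of real numbers, so the real logarithm recovers the exponents.
    simp only [Function.comp_def, Complex.ofReal_re] at h2
    have h3 := (h2.log (Real.exp_pos _).ne').neg
    simpa using h3
  have h2 : Tendsto (fun m => ∫ θ in (-Real.pi)..Real.pi, φ m (unitPt θ)) atTop
      (𝓝 (∫ θ in (-Real.pi)..Real.pi, ψ (unitPt θ))) := by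
    refine intervalIntegral.tendsto_integral_filter_of_dominated_convergence (fun _ => B)
      (Eventually.of_forall fun m => ?_) (Eventually.of_forall fun m => ?_) (by simp) ?_
    · exact ((hφ m).measurable.comp continuous_unitPt.measurable).aestronglyMeasurable
    · exact Eventually.of_forall fun θ _ => by
        rw [Real.norm_of_nonneg ((hφ m).nonneg _)]
        exact ((hφ m).le θ).trans (hB m)
    · exact Eventually.of_forall fun θ _ => hpt _
  simp_rw [fun m => (hφ m).integral_eq, hψ.integral_eq] at h2
  have hc := cosMoment_pos (by linarith : 0 ≤ α)
  simpa [← mul_assoc, inv_mul_cancel₀ hc.ne'] using h2.const_mul (cosMoment α)⁻¹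

end

/-! ### Trigonometric polynomials -/

section

variable {T : ℕ}

lemma trigPoly_sub (c d : ℤ →₀ (Fin T → ℂ)) (θ : ℝ) :
    trigPoly (c - d) θ = trigPoly c θ - trigPoly d θ :=
  Finsupp.sum_sub_index fun _ _ _ => smul_sub _ _ _

lemma linComb_sub {Ω : Type*} (ξ : ℤ → Fin T → Ω → ℂ) (c d : ℤ →₀ (Fin T → ℂ)) (ω : Ω) :
    linComb ξ (c - d) ω = linComb ξ c ω - linComb ξ d ω :=
  Finsupp.sum_sub_index fun _ _ _ => sub_dotProduct _ _ _

/-- The coefficients of `A_N`. -/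
noncomputable def targetCoeff {N : ℕ} (a : Fin (N + 1) → Fin T → ℂ) : ℤ →₀ (Fin T → ℂ) :=
  ∑ j : Fin (N + 1), Finsupp.single ((j : ℕ) : ℤ) (a j)

lemma trigPoly_targetCoeff {N : ℕ} (a : Fin (N + 1) → Fin T → ℂ) :
    trigPoly (targetCoeff a) = targetPoly a := by
  ext1 θ
  rw [trigPoly, targetCoeff, ← Finsupp.sum_finsetSum_index (by simp) (by simp [smul_add])]
  simp [targetPoly]

lemma linComb_targetCoeff {Ω : Type*} {N : ℕ} (a : Fin (N + 1) → Fin T → ℂ)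
    (ξ : ℤ → Fin T → Ω → ℂ) : linComb ξ (targetCoeff a) = target a ξ := by
  ext1 ω
  rw [linComb, targetCoeff, ← Finsupp.sum_finsetSum_index (by simp) (by simp [add_dotProduct])]
  simp [target]

lemma continuous_trigPoly (c : ℤ →₀ (Fin T → ℂ)) : Continuous (trigPoly c) := by
  unfold trigPoly Finsupp.sum
  fun_prop

lemma norm_trigPoly_le (c : ℤ →₀ (Fin T → ℂ)) (θ : ℝ) : ‖trigPoly c θ‖ ≤ c.sum fun _ v => ‖v‖ := by
  refine (norm_sum_le _ _).trans (Finset.sum_le_sum fun n _ => le_of_eq ?_)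
  have : Complex.I * n * θ = ((n * θ : ℝ) : ℂ) * Complex.I := by
    push_cast
    ring
  rw [norm_smul, this, Complex.norm_exp_ofReal_mul_I, one_mul]

/-! ### The norm of `L^α(f)` -/

variable {α : ℝ} {f : ℝ → Matrix (Fin T) (Fin T) ℂ}

lemma covForm_eq_sum (α : ℝ) (F : Matrix (Fin T) (Fin T) ℂ) (u v : Fin T → ℂ) :
    covForm α F u v = ∑ k, ∑ l, (u k * spow (α - 1) (v l)) * F k l := by
  simp only [covForm, dotProduct, Matrix.mulVec, Finset.mul_sum]
  exact Finset.sum_congr rfl fun _ _ => Finset.sum_congr rfl fun _ _ => by ring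

lemma IsSpectralDensity.aemeasurable_covForm (hf : IsSpectralDensity α f) {u : ℝ → Fin T → ℂ}
    (hu : AEMeasurable u (volume.restrict (Ioc (-Real.pi) Real.pi))) :
    AEMeasurable (fun θ => covForm α (f θ) (u θ) (u θ))
      (volume.restrict (Ioc (-Real.pi) Real.pi)) := by
  have h1 := fun k l => (hf.integrable k l).aestronglyMeasurable.aemeasurable
  have h2 := fun k => aemeasurable_pi_iff.1 hu k
  have h3 := fun k => (measurable_spow (α - 1)).comp_aemeasurable (h2 k)
  simp only [Function.comp_def] at h3
  simp_rw [covForm_eq_sum]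
  fun_prop

lemma IsSpectralDensity.integrable_covForm (hα : 1 < α) (hf : IsSpectralDensity α f)
    (c : ℤ →₀ (Fin T → ℂ)) :
    IntegrableOn (fun θ => covForm α (f θ) (trigPoly c θ) (trigPoly c θ))
      (Ioc (-Real.pi) Real.pi) := by
  set K := c.sum fun _ v => ‖v‖
  have hK : ∀ θ k, ‖trigPoly c θ k‖ ≤ K := fun θ k =>
    (norm_le_pi_norm _ k).trans (norm_trigPoly_le c θ)
  simp_rw [covForm_eq_sum]
  refine integrable_finsetSum _ fun k _ => integrable_finsetSum _ fun l _ => ?_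
  refine (hf.integrable k l).bdd_mul (c := K * K ^ (α - 1)) ?_ (Eventually.of_forall fun θ => ?_)
  · have h1 := (continuous_trigPoly c).measurable
    have h2 : Measurable fun θ => spow (α - 1) (trigPoly c θ l) :=
      (measurable_spow _).comp (measurable_pi_iff.1 h1 l)
    exact ((measurable_pi_iff.1 h1 k).mul h2).aestronglyMeasurable
  · rw [norm_mul]
    refine mul_le_mul (hK θ k) ((norm_spow_le (by linarith) _).trans ?_) (norm_nonneg _)
      ((norm_nonneg _).trans (hK θ k))
    exact Real.rpow_le_rpow (norm_nonneg _) (hK θ l) (by linarith)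

/-- The seminorm condition makes the integrand nonnegative almost everywhere, so the complex
covariation integral and the extended nonnegative one agree. -/
lemma IsSpectralDensity.ofReal_covariation (hα : 1 < α) (hf : IsSpectralDensity α f)
    (c : ℤ →₀ (Fin T → ℂ)) :
    ENNReal.ofReal (∫ θ in (-Real.pi)..Real.pi,
      covForm α (f θ) (trigPoly c θ) (trigPoly c θ)).re = normPow α f (trigPoly c) := by
  have hint := hf.integrable_covForm hα c
  rw [intervalIntegral.integral_of_le (by linarith [Real.pi_pos]), normPow,
    show (∫ θ in Ioc (-Real.pi) Real.pi, covForm α (f θ) (trigPoly c θ) (trigPoly c θ)).re =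
      ∫ θ in Ioc (-Real.pi) Real.pi, (covForm α (f θ) (trigPoly c θ) (trigPoly c θ)).re from
      (integral_re hint).symm]
  refine ofReal_integral_eq_lintegral_ofReal hint.re ?_
  filter_upwards [hf.seminorm] with θ hθ
  obtain ⟨ν, hν⟩ := hθ
  simp only [hν, Complex.ofReal_re, Pi.zero_apply]
  exact Real.rpow_nonneg (apply_nonneg ν _) _

/-- The seminorm of `L^α(f)`. -/
noncomputable def lpNorm (α : ℝ) (f : ℝ → Matrix (Fin T) (Fin T) ℂ) (u : ℝ → Fin T → ℂ) : ℝ≥0∞ :=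
  normPow α f u ^ (1 / α)

lemma normPow_neg (u : ℝ → Fin T → ℂ) : normPow α f (-u) = normPow α f u := by
  simp only [normPow, Pi.neg_apply, covForm_neg]

/-- The triangle inequality for the seminorm at each `θ`, followed by Minkowski's inequality for
scalar functions. Nothing is known about how the seminorm varies with `θ`; measurability of `g`
comes from its expression through `covForm`. -/
lemma IsSpectralDensity.lpNorm_add_le (hα : 1 < α) (hf : IsSpectralDensity α f)
    {u v : ℝ → Fin T → ℂ} (hu : AEMeasurable u (volume.restrict (Ioc (-Real.pi) Real.pi)))
    (hv : AEMeasurable v (volume.restrict (Ioc (-Real.pi) Real.pi))) :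
    lpNorm α f (u + v) ≤ lpNorm α f u + lpNorm α f v := by
  have hα0 : 0 < α := by linarith
  set g : (ℝ → Fin T → ℂ) → ℝ → ℝ≥0∞ := fun w θ =>
    ENNReal.ofReal (covForm α (f θ) (w θ) (w θ)).re ^ (1 / α) with hg
  have hpow : ∀ w, normPow α f w = ∫⁻ θ in Ioc (-Real.pi) Real.pi, g w θ ^ α := by
    intro w
    simp only [hg, normPow, ← ENNReal.rpow_mul, one_div_mul_cancel hα0.ne', ENNReal.rpow_one]
  have hmeas : ∀ {w : ℝ → Fin T → ℂ}, AEMeasurable w (volume.restrict (Ioc (-Real.pi) Real.pi)) →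
      AEMeasurable (g w) (volume.restrict (Ioc (-Real.pi) Real.pi)) := by
    intro w hw
    have := hf.aemeasurable_covForm hw
    exact (Complex.measurable_re.comp_aemeasurable this).ennreal_ofReal.pow_const _
  have hle : ∀ᵐ θ ∂(volume.restrict (Ioc (-Real.pi) Real.pi)), g (u + v) θ ≤ (g u + g v) θ := by
    filter_upwards [hf.seminorm] with θ hθ
    obtain ⟨ν, hν⟩ := hθ
    have hgν : ∀ w, g w θ = ENNReal.ofReal (ν (w θ)) := by
      intro w
      simp only [hg, hν, Complex.ofReal_re]
      rw [← ENNReal.ofReal_rpow_of_nonneg (apply_nonneg ν _) hα0.le, ← ENNReal.rpow_mul,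
        mul_one_div_cancel hα0.ne', ENNReal.rpow_one]
    rw [Pi.add_apply, hgν, hgν, hgν, ← ENNReal.ofReal_add (apply_nonneg ν _) (apply_nonneg ν _)]
    exact ENNReal.ofReal_le_ofReal (map_add_le_add ν _ _)
  simp only [lpNorm, hpow]
  refine le_trans ?_ (ENNReal.lintegral_Lp_add_le (hmeas hu) (hmeas hv) hα.le)
  gcongr ?_ ^ _
  exact lintegral_mono_ae (hle.mono fun θ hθ => ENNReal.rpow_le_rpow hθ hα0.le)

lemma IsSpectralDensity.lpNorm_sub_le (hα : 1 < α) (hf : IsSpectralDensity α f)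
    {u v : ℝ → Fin T → ℂ} (hu : AEMeasurable u (volume.restrict (Ioc (-Real.pi) Real.pi)))
    (hv : AEMeasurable v (volume.restrict (Ioc (-Real.pi) Real.pi))) :
    lpNorm α f (u - v) ≤ lpNorm α f u + lpNorm α f v := by
  have h := hf.lpNorm_add_le hα hu hv.neg
  rwa [← sub_eq_add_neg, lpNorm, lpNorm, lpNorm, normPow_neg] at h

lemma tendsto_lpNorm_zero (hα : 0 < α) {ι : Type*} {l : Filter ι} {u : ι → ℝ → Fin T → ℂ}
    (h : Tendsto (fun i => normPow α f (u i)) l (𝓝 0)) :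
    Tendsto (fun i => lpNorm α f (u i)) l (𝓝 0) := by
  have := (ENNReal.continuous_rpow_const (y := 1 / α)).tendsto 0 |>.comp h
  rwa [ENNReal.zero_rpow_of_pos (by positivity)] at this

/-! ### Optimal estimates and their spectral characteristics -/

/-- The error of `h` is the limit of the errors of trigonometric polynomials approaching `h`. -/
lemma IsSpectralDensity.tendsto_normPow_sub (hα : 1 < α) (hf : IsSpectralDensity α f)
    {p : ℤ →₀ (Fin T → ℂ)} {h : ℝ → Fin T → ℂ}
    (hh : AEMeasurable h (volume.restrict (Ioc (-Real.pi) Real.pi)))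
    {c : ℕ → ℤ →₀ (Fin T → ℂ)}
    (hc : Tendsto (fun m => normPow α f (fun θ => h θ - trigPoly (c m) θ)) atTop (𝓝 0)) :
    Tendsto (fun m => normPow α f (trigPoly (p - c m))) atTop
      (𝓝 (normPow α f (fun θ => trigPoly p θ - h θ))) := by
  have hα0 : 0 < α := by linarith
  have hd := tendsto_lpNorm_zero hα0 hc
  have hp := (continuous_trigPoly p).aemeasurable (μ := volume.restrict (Ioc (-Real.pi) Real.pi))
  have hcm := fun m =>
    (continuous_trigPoly (c m)).aemeasurable (μ := volume.restrict (Ioc (-Real.pi) Real.pi))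
  set d : ℕ → ℝ≥0∞ := fun m => lpNorm α f (fun θ => h θ - trigPoly (c m) θ)
  set e : ℝ≥0∞ := lpNorm α f (fun θ => trigPoly p θ - h θ) with he
  have hup : ∀ m, lpNorm α f (trigPoly (p - c m)) ≤ e + d m := by
    intro m
    rw [show trigPoly (p - c m) = (trigPoly p - h) + (h - trigPoly (c m)) by
      ext1 θ
      simp [trigPoly_sub]]
    exact hf.lpNorm_add_le hα (hp.sub hh) (hh.sub (hcm m))
  have hlow : ∀ m, e ≤ lpNorm α f (trigPoly (p - c m)) + d m := by
    intro m
    have h1 := hf.lpNorm_sub_le hα (hp.sub (hcm m)) (hh.sub (hcm m))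
    rwa [sub_sub_sub_cancel_right, ← show trigPoly (p - c m) = trigPoly p - trigPoly (c m) from
      funext fun θ => trigPoly_sub _ _ θ] at h1
  have hlim : Tendsto (fun m => lpNorm α f (trigPoly (p - c m))) atTop (𝓝 e) := by
    -- Truncated subtraction is continuous here because `d m` tends to the finite value `0`;
    -- finiteness of `e` is not needed.
    refine tendsto_of_tendsto_of_tendsto_of_le_of_le (g := fun m => e - d m) (h := fun m => e + d m)
      ?_ ?_ (fun m => tsub_le_iff_right.2 (hlow m)) hup
    · simpa using ENNReal.Tendsto.sub (tendsto_const_nhds (x := e)) hd (Or.inr ENNReal.zero_ne_top)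
    · simpa using (tendsto_const_nhds (x := e)).add hd
  have := (ENNReal.continuous_rpow_const (y := α)).tendsto e |>.comp hlim
  simpa only [he, lpNorm, Function.comp_def, ← ENNReal.rpow_mul, one_div_mul_cancel hα0.ne',
    ENNReal.rpow_one] using this

lemma exists_seq_of_mem_LN {N : ℕ} {h : ℝ → Fin T → ℂ} (hh : h ∈ LN α N f) :
    ∃ c : ℕ → ℤ →₀ (Fin T → ℂ), (∀ m, IsObserved N (c m)) ∧
      Tendsto (fun m => normPow α f (fun θ => h θ - trigPoly (c m) θ)) atTop (𝓝 0) := by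
  have h1 : ∀ m : ℕ, (0 : ℝ≥0∞) < ((m : ℝ≥0∞))⁻¹ := fun m => by simp
  choose c hc hlt using fun m : ℕ => hh.2.2 _ (h1 m)
  exact ⟨c, hc, tendsto_of_tendsto_of_tendsto_of_le_of_le tendsto_const_nhds
    ENNReal.tendsto_inv_nat_nhds_zero (fun _ => zero_le) fun m => (hlt m).le⟩

variable {Ω : Type*} [MeasurableSpace Ω] {P : Measure Ω} {N : ℕ}
  {a : Fin (N + 1) → Fin T → ℂ} {ξ : ℤ → Fin T → Ω → ℂ} {Y₀ : Ω → ℂ} {h₀ : ℝ → Fin T → ℂ}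

lemma IsHarmonizable.hasCovariation_error (hξ : IsHarmonizable α P ξ f) (c : ℤ →₀ (Fin T → ℂ)) :
    HasCovariation α P (fun ω => target a ξ ω - linComb ξ c ω)
      (fun ω => target a ξ ω - linComb ξ c ω)
      (∫ θ in (-Real.pi)..Real.pi, covForm α (f θ) (trigPoly (targetCoeff a - c) θ)
        (trigPoly (targetCoeff a - c) θ)) := by
  have h := hξ.2.2.2 (targetCoeff a - c) (targetCoeff a - c)
  have : linComb ξ (targetCoeff a - c) = fun ω => target a ξ ω - linComb ξ c ω := by
    ext1 ω
    rw [linComb_sub, linComb_targetCoeff]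
  rwa [this] at h

lemma IsHarmonizable.isEstimate_linComb (hξ : IsHarmonizable α P ξ f) {c : ℤ →₀ (Fin T → ℂ)}
    (hc : IsObserved N c) : IsEstimate P N ξ (linComb ξ c) := by
  refine ⟨(hξ.2.2.2 c c).1, fun _ => c, fun _ => hc, fun ε hε => ?_⟩
  simp [hε.ne']

/-- `IsOptimalEstimate` compares only real covariations, so the complex integral must be exhibited
as a real number. -/
lemma ofReal_re_integral_covForm (hf : IsSpectralDensity α f) (u : ℝ → Fin T → ℂ) :
    ((∫ θ in (-Real.pi)..Real.pi, covForm α (f θ) (u θ) (u θ)).re : ℂ) =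
      ∫ θ in (-Real.pi)..Real.pi, covForm α (f θ) (u θ) (u θ) := by
  have : ∫ θ in (-Real.pi)..Real.pi, covForm α (f θ) (u θ) (u θ) =
      ((∫ θ in (-Real.pi)..Real.pi, (covForm α (f θ) (u θ) (u θ)).re : ℝ) : ℂ) := by
    rw [← intervalIntegral.integral_ofReal]
    simp only [intervalIntegral.integral_of_le (by linarith [Real.pi_pos] : -Real.pi ≤ Real.pi)]
    refine integral_congr_ae ?_
    filter_upwards [hf.seminorm] with θ hθ
    obtain ⟨ν, hν⟩ := hθ
    simp [hν]
  rw [this, Complex.ofReal_re]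

/-- The spectral characteristic of the optimal estimate minimizes the error over `L_N^α(f)`. -/
theorem estError_le_of_isOptimalEstimate [IsProbabilityMeasure P] (hα : 1 < α)
    (hf : IsSpectralDensity α f) (hξ : IsHarmonizable α P ξ f)
    (hY₀ : IsOptimalEstimate α P a ξ Y₀) (hchar : HasCharacteristic α P N ξ f Y₀ h₀)
    {h : ℝ → Fin T → ℂ} (hh : h ∈ LN α N f) : estError α a h₀ f ≤ estError α a h f := by
  have hα0 : 0 < α := by linarith
  obtain ⟨-, r, hr, hopt⟩ := hY₀
  have hobs : ∀ c, IsObserved N c → ENNReal.ofReal r ≤ normPow α f (trigPoly (targetCoeff a - c)) := by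
    intro c hc
    rw [← hf.ofReal_covariation hα]
    refine ENNReal.ofReal_le_ofReal (hopt _ (hξ.isEstimate_linComb hc) _ ?_)
    rw [ofReal_re_integral_covForm hf]
    exact hξ.hasCovariation_error c
  have hrh : ENNReal.ofReal r ≤ estError α a h f := by
    obtain ⟨c, hc, hlim⟩ := exists_seq_of_mem_LN hh
    have := hf.tendsto_normPow_sub hα (p := targetCoeff a) hh.1 hlim
    rw [trigPoly_targetCoeff] at this
    exact ge_of_tendsto' this fun m => hobs _ (hc m)
  refine le_trans (le_of_eq ?_) hrh
  obtain ⟨-, hh₀, c, hc, hlim, hprob⟩ := hchar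
  -- Continuity of `‖·‖_α` is available for almost sure limits; a subsequence suffices, since the
  -- errors converge along the full sequence.
  obtain ⟨ns, hns, hae⟩ := hprob.exists_seq_tendsto_ae
  have herr := hf.tendsto_normPow_sub hα (p := targetCoeff a) hh₀.1 hlim
  rw [trigPoly_targetCoeff] at herr
  -- Finiteness of the limit supplies the real bound used for domination.
  have hfin : estError α a h₀ f ≠ ∞ := by
    have hA : lpNorm α f (targetPoly a) < ∞ := by
      rw [lpNorm, ← trigPoly_targetCoeff, ← hf.ofReal_covariation hα]
      exact ENNReal.rpow_lt_top_of_nonneg (by positivity) ENNReal.ofReal_ne_top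
    have hH : lpNorm α f h₀ < ∞ := ENNReal.rpow_lt_top_of_nonneg (by positivity) hh₀.2.1.ne
    have hAm : AEMeasurable (targetPoly a) (volume.restrict (Ioc (-Real.pi) Real.pi)) := by
      rw [← trigPoly_targetCoeff]
      exact (continuous_trigPoly _).aemeasurable
    have := (hf.lpNorm_sub_le hα hAm hh₀.1).trans_lt (ENNReal.add_lt_top.2 ⟨hA, hH⟩)
    exact (ENNReal.rpow_lt_top_iff_of_pos (by positivity)).1 this |>.ne
  set rs : ℕ → ℂ := fun m => ∫ θ in (-Real.pi)..Real.pi, covForm α (f θ)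
    (trigPoly (targetCoeff a - c (ns m)) θ) (trigPoly (targetCoeff a - c (ns m)) θ) with hrs
  have hrs' : Tendsto (fun m => ENNReal.ofReal (rs m).re) atTop (𝓝 (estError α a h₀ f)) := by
    simp only [hrs, hf.ofReal_covariation hα]
    exact herr.comp hns.tendsto_atTop
  have hev : ∀ᶠ m in atTop, (rs m).re ≤ (estError α a h₀ f + 1).toReal := by
    filter_upwards [hrs'.eventually_lt_const (ENNReal.lt_add_right hfin one_ne_zero)] with m hm
    exact (ENNReal.ofReal_le_iff_le_toReal (by simp [hfin])).1 hm.le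
  obtain ⟨M, hM⟩ := eventually_atTop.1 hev
  -- The bound holds only from index `M` on, hence the shift.
  have hlimr : Tendsto (fun m => (rs (m + M)).re) atTop (𝓝 r) := by
    have := tendsto_covariation_of_ae_tendsto hα
      (fun m => hξ.hasCovariation_error (a := a) (c (ns (m + M)))) hr
      (fun m => hM (m + M) (Nat.le_add_left _ _)) (by
        filter_upwards [hae] with ω hω
        exact (hω.comp (tendsto_add_atTop_nat M)).const_sub _)
    simpa using this
  exact tendsto_nhds_unique (hrs'.comp (tendsto_add_atTop_nat M)) (ENNReal.tendsto_ofReal hlimr)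

theorem optimalError_eq_of_isOptimalEstimate [IsProbabilityMeasure P] (hα : 1 < α)
    (hf : IsSpectralDensity α f) (hξ : IsHarmonizable α P ξ f)
    (hY₀ : IsOptimalEstimate α P a ξ Y₀) (hchar : HasCharacteristic α P N ξ f Y₀ h₀) :
    optimalError α a f = estError α a h₀ f :=
  le_antisymm (iInf₂_le _ hchar.2.1) <| le_iInf₂ fun _ hh =>
    estError_le_of_isOptimalEstimate hα hf hξ hY₀ hchar hh

end

end StableInterpolation

theorem mainTheorem12 {Ω : Type*} [MeasurableSpace Ω] (P : Measure Ω) [IsProbabilityMeasure P]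
    {T N : ℕ} (α : ℝ) (hα : 1 < α) (hα' : α ≤ 2)
    (a : Fin (N + 1) → Fin T → ℂ)
    (D : Set (ℝ → Matrix (Fin T) (Fin T) ℂ)) (hD : ∀ f ∈ D, IsSpectralDensity α f)
    (f₀ : ℝ → Matrix (Fin T) (Fin T) ℂ) (hf₀ : f₀ ∈ D) (hmin : IsMinimal α f₀)
    (ξ : ℤ → Fin T → Ω → ℂ) (hξ : IsHarmonizable α P ξ f₀)
    (Y₀ : Ω → ℂ) (hY₀ : IsOptimalEstimate α P a ξ Y₀)
    (h₀ : ℝ → Fin T → ℂ) (hchar : HasCharacteristic α P N ξ f₀ Y₀ h₀)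
    (hmax : IsMaxOn (estError α a h₀) D f₀)
    (hHD : h₀ ∈ HD α N D) :
    optimalError α a f₀ = estError α a h₀ f₀ ∧
      IsLeastFavorable α a D f₀ ∧ IsMinimax α a D h₀ := by
  have hopt := optimalError_eq_of_isOptimalEstimate hα (hD f₀ hf₀) hξ hY₀ hchar
  have hmem : ∀ h ∈ HD α N D, ∀ f ∈ D, h ∈ LN α N f := fun h hh => mem_iInter₂.1 hh
  have hle : ∀ f ∈ D, estError α a h₀ f ≤ estError α a h₀ f₀ := isMaxOn_iff.1 hmax
  refine ⟨hopt, ⟨hf₀, fun f hf => ?_⟩, hHD, estError α a h₀ f₀, ⟨⟨f₀, hf₀, rfl⟩, ?_⟩,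
    ⟨h₀, hHD, ?_⟩, ?_⟩
  -- Membership in `H_D` makes `h₀` admissible for every `f ∈ D`, hence an upper bound for `Δ(f)`.
  · exact hopt ▸ (iInf₂_le h₀ (hmem h₀ hHD f hf)).trans (hle f hf)
  · rintro _ ⟨f, hf, rfl⟩
    exact hle f hf
  · exact le_antisymm (iSup₂_le hle) (le_iSup₂_of_le f₀ hf₀ le_rfl)
  -- Any `h ∈ H_D` is admissible for `f₀`, where it cannot beat `h₀`.
  · rintro _ ⟨h, hh, rfl⟩
    exact (hopt ▸ iInf₂_le h (hmem h hh f₀ hf₀) : estError α a h₀ f₀ ≤ estError α a h f₀).trans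
      (le_iSup₂_of_le f₀ hf₀ le_rfl)
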